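/- Let $d\ge 3$, let $T_d=(V,E)$ be the $d$-regular tree, and let $\mathrm{Aut}(T_d)$ carry the permutation topology (generated by the sets $\{g\mid gx=y\}$ with $x,y\in V$). For $H\le\mathrm{Aut}(T_d)$ and an integer $k\ge 1$, let $$H^{(P_k)}=\{g\in\mathrm{Aut}(T_d)\mid \forall x\in V\ \exists h\in H:\ g|_{B(x,k)}=h|_{B(x,k)}\},$$ where $B(x,k)$ is the ball of radius $k$ around $x$, and let $H^{+_k}=\langle H_{e^{k-1}}\mid e\in E\rangle$, where $H_{e^{k-1}}$ is the pointwise stabilizer in $H$ of the subtree $e^{k-1}$ spanned by the vertices at distance at most $k-1$ from the edge $e$. Theorem. Let $\Omega$ be a set with $|\Omega|=d$ and let $F\le\mathrm{Sym}(\Omega)$ be transitive. Suppose that for every $\omega\in\Omega$ every non-trivial subnormal subgroup of the point stabilizer $F_\omega$ is transitive on $\Omega\setminus\{\omega\}$. Let $H\le\mathrm{Aut}(T_d)$ be a non-discrete subgroup that contains an involutive inversion (an element of order $2$ that maps some edge to its reverse), and that is locally permutation isomorphic to $F$, i.e. for every $x\in V$ the permutation group induced by the vertex stabilizer $H_x$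 on the set of edges issuing from $x$ is permutation isomorphic to $F$. If $k,l\ge 1$ are integers with $H^{(P_k)}\ne H^{(P_l)}$, then $(H^{(P_k)})^{+_k}$ and $(H^{(P_l)})^{+_l}$ are not isomorphic as topological groups (with the subspace topologies). -/

import Mathlib

namespace TreeAut

/-- The permutation topology on the automorphism group of a graph: it is generated by the sets
`{g | g x = y}` with `x`, `y` vertices. Since an edge of a simple graph is given by its endpoints,
this is also the permutation topology for the action on vertices and edges. -/
instance permutationTopology {V : Type*} (G : SimpleGraph V) : TopologicalSpace (G ≃g G) :=
  TopologicalSpace.generateFrom {U | ∃ x y : V, U = {g : G ≃g G | g x = y}}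

theorem dist_apply_le {V : Type*} {G : SimpleGraph V} (hG : G.Connected) (g : G ≃g G) (x y : V) :
    G.dist (g x) (g y) ≤ G.dist x y := by
  obtain ⟨p, hp⟩ := hG.exists_walk_length_eq_dist x y
  rw [← hp, ← SimpleGraph.Walk.length_map (g : G →g G) p]
  exact SimpleGraph.dist_le _

/-- The local action `H_x^{(1)}` of `H` at the vertex `x`: the permutation group which the
stabilizer `H_x` induces on the set of edges issuing from `x`; such an edge is recorded by its
terminal vertex, a neighbour of `x`. -/
def localAction {V : Type*} {G : SimpleGraph V} (H : Subgroup (G ≃g G)) (x : V) :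
    Subgroup (Equiv.Perm (G.neighborSet x)) where
  carrier := {σ | ∃ h ∈ H, h x = x ∧ ∀ y : G.neighborSet x, ((σ y : V)) = h y}
  one_mem' := ⟨1, H.one_mem, rfl, fun _ => rfl⟩
  mul_mem' := by
    rintro σ τ ⟨h, hH, hx, hσ⟩ ⟨k, kH, kx, kτ⟩
    refine ⟨h * k, H.mul_mem hH kH, ?_, fun y => ?_⟩
    · rw [RelIso.mul_apply, kx, hx]
    · rw [RelIso.mul_apply, ← kτ y, ← hσ (τ y), Equiv.Perm.mul_apply]
  inv_mem' := by
    rintro σ ⟨h, hH, hx, hσ⟩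
    refine ⟨h⁻¹, H.inv_mem hH, ?_, fun y => ?_⟩
    · nth_rewrite 1 [← hx]
      exact RelIso.inv_apply_self h x
    · have e := hσ (σ⁻¹ y)
      rw [show σ (σ⁻¹ y) = y from Equiv.apply_symm_apply σ y] at e
      rw [e]
      exact (RelIso.inv_apply_self h _).symm

/-- Two permutation groups are permutation isomorphic if some bijection between the sets they act
on conjugates one to the other. -/
def PermIsomorphic {α β : Type*} (A : Subgroup (Equiv.Perm α)) (B : Subgroup (Equiv.Perm β)) :
    Prop :=
  ∃ e : α ≃ β, A.map e.permCongrHom.toMonoidHom = B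

/-- `H` is locally permutation isomorphic to `F`. -/
def LocallyPermIsomorphic {V Ω : Type*} {G : SimpleGraph V} (H : Subgroup (G ≃g G))
    (F : Subgroup (Equiv.Perm Ω)) : Prop :=
  ∀ x : V, PermIsomorphic (localAction H x) F

/-- `H` contains an element of order two that maps some edge to its reverse. -/
def HasInvolutiveInversion {V : Type*} {G : SimpleGraph V} (H : Subgroup (G ≃g G)) : Prop :=
  ∃ h ∈ H, h * h = 1 ∧ ∃ x y : V, G.Adj x y ∧ h x = y ∧ h y = x

/-- The `(P_k)`-closure of `H`: all automorphisms of `G` which on every ball of radius `k`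
agree with some element of `H`. -/
def pkClosure {V : Type*} {G : SimpleGraph V} (hG : G.Connected) (H : Subgroup (G ≃g G)) (k : ℕ) :
    Subgroup (G ≃g G) where
  carrier := {g | ∀ x : V, ∃ h ∈ H, ∀ y : V, G.dist x y ≤ k → g y = h y}
  one_mem' := fun _ => ⟨1, H.one_mem, fun _ _ => rfl⟩
  mul_mem' := by
    intro a b ha hb x
    obtain ⟨h, hH, hh⟩ := hb x
    obtain ⟨h', hH', hh'⟩ := ha (b x)
    refine ⟨h' * h, H.mul_mem hH' hH, fun y hy => ?_⟩
    rw [RelIso.mul_apply, RelIso.mul_apply, ← hh y hy]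
    exact hh' (b y) ((dist_apply_le hG b x y).trans hy)
  inv_mem' := by
    intro a ha x
    obtain ⟨h, hH, hh⟩ := ha (a⁻¹ x)
    refine ⟨h⁻¹, H.inv_mem hH, fun y hy => ?_⟩
    have e := hh (a⁻¹ y) ((dist_apply_le hG a⁻¹ x y).trans hy)
    rw [RelIso.apply_inv_self] at e
    nth_rewrite 2 [e]
    exact (RelIso.inv_apply_self h _).symm

/-- The subgroup `H^{+_k}` (for `k ≥ 1`), generated by the pointwise stabilizers in `H` of the
subtrees `e^{k-1}`, `e = (x, y)` an edge, where `e^{k-1}` consists of the vertices at distance at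
most `k - 1` from `e`, that is from `x` or from `y`. -/
def plusSubgroup {V : Type*} {G : SimpleGraph V} (H : Subgroup (G ≃g G)) (k : ℕ) :
    Subgroup (G ≃g G) :=
  Subgroup.closure {h | h ∈ H ∧ ∃ x y : V, G.Adj x y ∧
    ∀ v : V, (G.dist x v ≤ k - 1 ∨ G.dist y v ≤ k - 1) → h v = v}

end TreeAut

/-! Write `N_k` for the group `(H^{(P_k)})^{+_k}`, and let `k ≤ l`. The tree can be recovered from
`N_k` as a topological group. By `edgeMoving_plusSubgroup`, the fixator of an edge fixes only its
endpoints and the stabilizer of a vertex fixes no other vertex, so adjacency is visible in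
stabilizers (`EdgeMoving.adj_iff`). A continuous isomorphism `N_k ≃ N_l` sends a vertex stabilizer
to a group with finite orbits; as `N_l` preserves types, that group fixes a vertex. So the
isomorphism is conjugation by some `α ∈ Aut(T)` (`exists_conj_of_continuousMulEquiv`).

Since `H` is vertex-transitive and normalizes `N_l`, some `β = h * α` with `h ∈ H` fixes a vertex
and still conjugates `N_k` into `N_l ≤ N_k`. Powers of `β` approximate `β⁻¹` on finite sets and
`N_k` is closed, so `β⁻¹` also conjugates `N_k` into itself (`conj_inv_mem_of_conj_mem`); hence `N_k
= N_l`. Finally `H^{(P_k)} = H N_k = H N_l ≤ H^{(P_l)}`. -/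

namespace TreeAut

variable {V Ω : Type*} {T : SimpleGraph V}

/-! ### Distances in trees -/

theorem dist_apply (hT : T.Connected) (g : T ≃g T) (x y : V) : T.dist (g x) (g y) = T.dist x y := by
  refine le_antisymm (dist_apply_le hT g x y) ?_
  have h := dist_apply_le hT g⁻¹ (g x) (g y)
  rwa [RelIso.inv_apply_self, RelIso.inv_apply_self] at h

theorem finite_closedBall [T.LocallyFinite] (hT : T.Connected) (x : V) (n : ℕ) :
    {v | T.dist x v ≤ n}.Finite := by
  induction n with
  | zero =>
    refine (Set.finite_singleton x).subset fun v hv => ?_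
    have : T.dist x v = 0 := by simpa using hv
    exact (hT.dist_eq_zero_iff.mp this).symm
  | succ n ih =>
    refine (ih.union (ih.biUnion fun u _ => (T.neighborSet u).toFinite)).subset fun v hv => ?_
    obtain ⟨p, hp⟩ := hT.exists_walk_length_eq_dist v x
    cases p with
    | nil => left; simp
    | @cons _ u _ h q =>
      right
      have h1 : T.dist u x ≤ q.length := SimpleGraph.dist_le q
      simp only [SimpleGraph.Walk.length_cons] at hp
      have hv' : T.dist x v ≤ n + 1 := hv
      rw [T.dist_comm] at hv'
      simp only [Set.mem_iUnion, Set.mem_ofPred_eq]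
      refine ⟨u, ?_, h.symm⟩
      rw [T.dist_comm]; omega

theorem exists_adj_dist_lt (hT : T.Connected) {x z : V} (h : x ≠ z) :
    ∃ u, T.Adj x u ∧ T.dist x z = T.dist u z + 1 := by
  obtain ⟨p, hp⟩ := hT.exists_walk_length_eq_dist x z
  cases p with
  | nil => exact absurd rfl h
  | @cons _ u _ ha q =>
    refine ⟨u, ha, ?_⟩
    have h1 : T.dist u z ≤ q.length := SimpleGraph.dist_le q
    simp only [SimpleGraph.Walk.length_cons] at hp
    have := ha.diff_dist_adj (u := z)
    rw [T.dist_comm (u := z), T.dist_comm (u := z)] at this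
    omega

theorem dist_adj (hT : T.IsTree) {u v : V} (h : T.Adj u v) (o : V) :
    T.dist u o = T.dist v o + 1 ∨ T.dist v o = T.dist u o + 1 := by
  have := hT.dist_eq_dist_add_one_of_adj o h
  rw [T.dist_comm (u := o), T.dist_comm (u := o)] at this
  exact this

/-- In a tree a vertex has at most one neighbour that is closer to a given vertex. -/
theorem eq_of_adj_of_dist_lt (hT : T.IsTree) {m a b o : V} (ha : T.Adj m a) (hb : T.Adj m b)
    (hao : T.dist a o < T.dist m o) (hbo : T.dist b o < T.dist m o) : a = b := by
  have key : ∀ {c : V} (hc : T.Adj m c), T.dist c o < T.dist m o →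
      ∃ p : T.Walk c o, (SimpleGraph.Walk.cons hc p).IsPath := by
    intro c hc hco
    obtain ⟨p, hp⟩ := hT.connected.exists_walk_length_eq_dist c o
    refine ⟨p, SimpleGraph.Walk.isPath_of_length_eq_dist _ ?_⟩
    rw [SimpleGraph.Walk.length_cons, hp]
    rcases dist_adj hT hc o with h | h <;> omega
  obtain ⟨p, hp⟩ := key ha hao
  obtain ⟨q, hq⟩ := key hb hbo
  have := (hT.existsUnique_path m o).unique hp hq
  simpa using congrArg SimpleGraph.Walk.snd this

/-- An automorphism that fixes `x` and `z` fixes the neighbour of `x` in the direction of `z`. -/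
theorem fix_of_fix_of_dist_lt (hT : T.IsTree) {g : T ≃g T} {x z u : V} (hx : g x = x) (hz : g z = z)
    (hu : T.Adj x u) (hd : T.dist u z < T.dist x z) : g u = u := by
  refine eq_of_adj_of_dist_lt hT (m := x) (o := z) ?_ hu ?_ hd
  · have := g.map_rel_iff.mpr hu
    rwa [hx] at this
  · have := dist_apply hT.connected g u z
    rw [hz] at this
    omega

/-- A tree is bipartite: each step of a walk from `b` to `c` changes the parity of the distance to
`a`. -/
theorem even_dist_add (hT : T.IsTree) (a b c : V) :
    Even (T.dist a b + T.dist b c + T.dist a c) := by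
  have key : ∀ {u v : V} (p : T.Walk u v), Even (T.dist u a + p.length + T.dist v a) := by
    intro u v p
    induction p with
    | nil => simp
    | @cons u w v h q ih =>
      rw [SimpleGraph.Walk.length_cons]
      rcases dist_adj hT h a with h | h <;> grind
  obtain ⟨p, hp⟩ := hT.connected.exists_walk_length_eq_dist b c
  have := key p
  rwa [hp, T.dist_comm (u := b), T.dist_comm (u := c)] at this

/-- The distance to a fixed vertex keeps increasing along a geodesic of a tree once it increases. -/
theorem dist_lt_of_geodesic (hT : T.IsTree) (o : V) {c m c' : V} (p : T.Walk m c')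
    (hcm : T.Adj c m) (hp : p.length = T.dist m c') (hc : T.dist c c' = T.dist m c' + 1)
    (ho : T.dist m o = T.dist c o + 1) : T.dist c' o = T.dist m o + p.length := by
  induction p generalizing c with
  | nil => simp
  | @cons m w c' h q ih =>
    have h1 : T.dist w c' ≤ q.length := SimpleGraph.dist_le q
    rw [SimpleGraph.Walk.length_cons] at hp ⊢
    have h2 : T.dist m c' = T.dist w c' + 1 := by
      rcases dist_adj hT h c' with h | h <;> omega
    have h3 : T.dist w o = T.dist m o + 1 := by
      rcases dist_adj hT h o with h' | h'
      -- Approaching `o` again would mean backtracking to `c`, which a geodesic towards `c'` does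
      -- not do.
      · have : c = w := eq_of_adj_of_dist_lt hT hcm.symm h (o := o) (by omega) (by omega)
        subst this
        omega
      · exact h'
    have := ih h (by omega) h2 h3
    omega

/-- Strict convexity of the distance to `o`: a first step that does not approach `o` makes the
distance grow all the way to `c'`. -/
theorem dist_lt_max (hT : T.IsTree) {c m c' : V} (hcm : T.Adj c m)
    (hc : T.dist c c' = T.dist m c' + 1) (hm : m ≠ c') (o : V) :
    T.dist m o < max (T.dist c o) (T.dist c' o) := by
  rcases dist_adj hT hcm o with h | h
  · exact lt_max_of_lt_left (by omega)
  · obtain ⟨p, hp⟩ := hT.connected.exists_walk_length_eq_dist m c'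
    have h1 := dist_lt_of_geodesic hT o p hcm hp hc h
    have := hT.connected.pos_dist_of_ne hm
    exact lt_max_of_lt_right (by omega)

/-! ### Fixed vertices of groups with a finite orbit -/

/-- A group of type-preserving automorphisms of a tree with a finite orbit has a fixed vertex. -/
theorem exists_fixed_of_finite_orbit (hT : T.IsTree) (K : Subgroup (T ≃g T))
    (heven : ∀ g ∈ K, ∀ v, Even (T.dist v (g v))) (v₀ : V)
    (hfin : {v | ∃ g ∈ K, g v₀ = v}.Finite) : ∃ c, ∀ g ∈ K, g c = c := by
  set O : Finset V := hfin.toFinset with hO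
  have memO : ∀ {v}, v ∈ O ↔ ∃ g ∈ K, g v₀ = v := by simp [hO]
  have hne : O.Nonempty := ⟨v₀, memO.mpr ⟨1, K.one_mem, rfl⟩⟩
  let ecc : V → ℕ := fun v => O.sup (T.dist v)
  have hinv : ∀ g ∈ K, ∀ v, ecc (g v) ≤ ecc v := by
    intro g hg v
    refine Finset.sup_le fun o ho => ?_
    obtain ⟨n, hn, rfl⟩ := memO.mp ho
    have h1 : g⁻¹ (n v₀) ∈ O := memO.mpr ⟨g⁻¹ * n, K.mul_mem (K.inv_mem hg) hn, rfl⟩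
    have h2 := dist_apply hT.connected g v (g⁻¹ (n v₀))
    rw [RelIso.apply_inv_self] at h2
    rw [h2]
    exact Finset.le_sup (f := T.dist v) h1
  -- `c` is a centre of the orbit. If `g` moved it, the next vertex `m` towards `g c` would have
  -- smaller eccentricity by convexity.
  obtain ⟨c, hc⟩ : ∃ c, ∀ v, ecc c ≤ ecc v := by
    obtain ⟨c, hc⟩ := Nat.sInf_mem (⟨_, v₀, rfl⟩ : (Set.range ecc).Nonempty)
    exact ⟨c, fun v => hc.symm ▸ Nat.sInf_le ⟨v, rfl⟩⟩
  refine ⟨c, fun g hg => ?_⟩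
  by_contra hgc
  obtain ⟨m, hm, hd⟩ := exists_adj_dist_lt hT.connected (Ne.symm hgc)
  -- Even displacement rules out a pair of adjacent centres swapped by `g`.
  have hmc : m ≠ g c := by
    rintro rfl
    have := heven g hg c
    rw [hd, T.dist_self] at this
    exact absurd this (by decide)
  obtain ⟨o, ho, hoe⟩ := Finset.exists_mem_eq_sup O hne (T.dist m)
  have h1 := dist_lt_max hT hm hd hmc o
  have h2 : T.dist c o ≤ ecc c := Finset.le_sup (f := T.dist c) ho
  have h3 : T.dist (g c) o ≤ ecc (g c) := Finset.le_sup (f := T.dist (g c)) ho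
  have h4 := hinv g hg c
  have h5 : ecc m = T.dist m o := hoe
  have h6 := hc m
  have := max_le h2 (h3.trans h4)
  omega

/-! ### The permutation topology -/

theorem exists_finite_of_isOpen {U : Set (T ≃g T)} (hU : IsOpen U) {g : T ≃g T} (hg : g ∈ U) :
    ∃ S : Set V, S.Finite ∧ ∀ g' : T ≃g T, (∀ s ∈ S, g' s = g s) → g' ∈ U := by
  induction hU with
  | basic U hU =>
    obtain ⟨x, y, rfl⟩ := hU
    exact ⟨{x}, Set.finite_singleton x, fun g' h => (h x rfl).trans hg⟩
  | univ => exact ⟨∅, Set.finite_empty, fun _ _ => trivial⟩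
  | inter A B _ _ ihA ihB =>
    obtain ⟨S, hS, h⟩ := ihA hg.1
    obtain ⟨S', hS', h'⟩ := ihB hg.2
    exact ⟨S ∪ S', hS.union hS', fun g' hg' =>
      ⟨h g' fun s hs => hg' s (Or.inl hs), h' g' fun s hs => hg' s (Or.inr hs)⟩⟩
  | sUnion C _ ih =>
    obtain ⟨A, hA, hgA⟩ := hg
    obtain ⟨S, hS, h⟩ := ih A hA hgA
    exact ⟨S, hS, fun g' hg' => ⟨A, hA, h g' hg'⟩⟩

theorem isOpen_apply_eq (x y : V) : IsOpen {g : T ≃g T | g x = y} :=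
  TopologicalSpace.isOpen_generateFrom_of_mem ⟨x, y, rfl⟩

/-- In a non-discrete group the pointwise stabilizers of finite sets are non-trivial. -/
theorem exists_ne_one_of_not_discrete {H : Subgroup (T ≃g T)} (hH : ¬ DiscreteTopology H)
    {S : Set V} (hS : S.Finite) : ∃ g ∈ H, (∀ s ∈ S, g s = s) ∧ g ≠ 1 := by
  by_contra! hcon
  refine hH (discreteTopology_iff_isOpen_singleton.mpr fun g => ?_)
  have h1 : IsOpen (⋂ s ∈ S, {g' : T ≃g T | g' s = g.1 s}) :=
    hS.isOpen_biInter fun s _ => isOpen_apply_eq s _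
  convert h1.preimage (continuous_subtype_val (p := (· ∈ H)))
  ext g'
  simp only [Set.mem_singleton_iff, Set.mem_preimage, Set.mem_iInter, Set.mem_ofPred_eq]
  refine ⟨fun h => by simp [h], fun h => ?_⟩
  have := hcon (g.1⁻¹ * g'.1) (H.mul_mem (H.inv_mem g.2) g'.2) fun s hs => by
    rw [RelIso.mul_apply, h s hs, RelIso.inv_apply_self]
  exact Subtype.ext (inv_mul_eq_one.mp this).symm

/-! ### Formal properties of closures and plus subgroups -/

theorem conj_mem_plusSubgroup (hT : T.Connected) {K : Subgroup (T ≃g T)} {g : T ≃g T}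
    (hg : ∀ h ∈ K, g * h * g⁻¹ ∈ K) {k : ℕ} {n : T ≃g T} (hn : n ∈ plusSubgroup K k) :
    g * n * g⁻¹ ∈ plusSubgroup K k := by
  induction hn using Subgroup.closure_induction with
  | mem h hh =>
    obtain ⟨hK, x, y, hxy, hfix⟩ := hh
    refine Subgroup.subset_closure ⟨hg h hK, g x, g y, g.map_rel_iff.mpr hxy, fun v hv => ?_⟩
    rw [← RelIso.apply_inv_self g v, dist_apply hT, dist_apply hT] at hv
    rw [RelIso.mul_apply, RelIso.mul_apply, hfix _ hv, RelIso.apply_inv_self]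
  | one => simp
  | mul a b _ _ iha ihb =>
    have : g * (a * b) * g⁻¹ = (g * a * g⁻¹) * (g * b * g⁻¹) := by group
    exact this ▸ mul_mem iha ihb
  | inv a _ iha =>
    have : g * a⁻¹ * g⁻¹ = (g * a * g⁻¹)⁻¹ := by group
    exact this ▸ inv_mem iha

theorem plusSubgroup_le (H : Subgroup (T ≃g T)) (k : ℕ) : plusSubgroup H k ≤ H :=
  (Subgroup.closure_le H).mpr fun _ h => h.1

theorem plusSubgroup_anti {H K : Subgroup (T ≃g T)} (hHK : H ≤ K) {k l : ℕ} (hkl : k ≤ l) :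
    plusSubgroup H l ≤ plusSubgroup K k :=
  Subgroup.closure_mono fun _ ⟨hH, x, y, hxy, hf⟩ =>
    ⟨hHK hH, x, y, hxy, fun v hv => hf v (hv.imp (fun h => by omega) (fun h => by omega))⟩

theorem le_pkClosure (hT : T.Connected) (H : Subgroup (T ≃g T)) (k : ℕ) : H ≤ pkClosure hT H k :=
  fun h hh _ => ⟨h, hh, fun _ _ => rfl⟩

theorem pkClosure_anti (hT : T.Connected) (H : Subgroup (T ≃g T)) {k l : ℕ} (hkl : k ≤ l) :
    pkClosure hT H l ≤ pkClosure hT H k := fun _ hg x =>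
  let ⟨h, hh, hy⟩ := hg x
  ⟨h, hh, fun y hyk => hy y (hyk.trans hkl)⟩

/-- A generator fixes a vertex `x`, so `v` and its image are equidistant from `x` and lie in the
same class of the bipartition. -/
theorem even_dist_of_mem_plusSubgroup (hT : T.IsTree) {K : Subgroup (T ≃g T)} {k : ℕ}
    {g : T ≃g T} (hg : g ∈ plusSubgroup K k) (v : V) : Even (T.dist v (g v)) := by
  induction hg using Subgroup.closure_induction generalizing v with
  | mem h hh =>
    obtain ⟨-, x, y, -, hfix⟩ := hh
    have h1 : h x = x := hfix x (Or.inl (by simp))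
    have h2 := even_dist_add hT v x (h v)
    have h3 := dist_apply hT.connected h x v
    rw [h1] at h3
    rw [h3, T.dist_comm (u := v) (v := x)] at h2
    grind
  | one => simp
  | mul a b _ _ iha ihb =>
    have h1 := even_dist_add hT v (b v) (a (b v))
    have := iha (b v)
    have := ihb v
    rw [RelIso.mul_apply]
    grind
  | inv a _ iha =>
    have := iha (a⁻¹ v)
    rwa [RelIso.apply_inv_self, T.dist_comm] at this

/-! ### Local actions and edge-moving groups -/

/-- The fixator of each arc `(x, y)` moves every neighbour of `y` other than `x`. -/
def EdgeMoving (N : Subgroup (T ≃g T)) : Prop :=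
  ∀ x y w : V, T.Adj x y → T.Adj y w → w ≠ x → ∃ g ∈ N, g x = x ∧ g y = y ∧ g w ≠ w

/-- `σ` describes, in the coordinates `e`, the action of `g` on the neighbours of `y`. -/
def Induces {y : V} (e : T.neighborSet y ≃ Ω) (σ : Equiv.Perm Ω) (g : T ≃g T) : Prop :=
  ∀ z : T.neighborSet y, (e.symm (σ (e z)) : V) = g z

theorem Induces.mul {y : V} {e : T.neighborSet y ≃ Ω} {σ τ : Equiv.Perm Ω} {g h : T ≃g T}
    (hσ : Induces e σ g) (hτ : Induces e τ h) : Induces e (σ * τ) (g * h) := by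
  intro z
  have := hσ (e.symm (τ (e z)))
  rw [hτ z, Equiv.apply_symm_apply] at this
  exact this

theorem Induces.inv {y : V} {e : T.neighborSet y ≃ Ω} {σ : Equiv.Perm Ω} {g : T ≃g T}
    (hσ : Induces e σ g) : Induces e σ⁻¹ g⁻¹ := by
  intro z
  have := hσ (e.symm (σ⁻¹ (e z)))
  rw [Equiv.apply_symm_apply, show σ (σ⁻¹ (e z)) = e z from Equiv.apply_symm_apply σ _,
    Equiv.symm_apply_apply] at this
  rw [this, RelIso.inv_apply_self]

theorem Induces.one {y : V} (e : T.neighborSet y ≃ Ω) : Induces e 1 (1 : T ≃g T) := fun z => by simp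

theorem exists_induces_of_mem {H : Subgroup (T ≃g T)} {F : Subgroup (Equiv.Perm Ω)} {y : V}
    {e : T.neighborSet y ≃ Ω} (he : (localAction H y).map e.permCongrHom.toMonoidHom = F)
    {σ : Equiv.Perm Ω} (hσ : σ ∈ F) : ∃ h ∈ H, h y = y ∧ Induces e σ h := by
  rw [← he] at hσ
  obtain ⟨ρ, ⟨h, hH, hy, hρ⟩, rfl⟩ := hσ
  refine ⟨h, hH, hy, fun z => ?_⟩
  rw [← hρ z]
  simp

theorem exists_induced {H : Subgroup (T ≃g T)} {F : Subgroup (Equiv.Perm Ω)} {y : V}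
    {e : T.neighborSet y ≃ Ω} (he : (localAction H y).map e.permCongrHom.toMonoidHom = F)
    {h : T ≃g T} (hH : h ∈ H) (hy : h y = y) : ∃ σ ∈ F, Induces e σ h := by
  have hadj : ∀ z, h z ∈ T.neighborSet y ↔ z ∈ T.neighborSet y := fun z => by
    have : T.Adj (h y) (h z) ↔ T.Adj y z := h.map_rel_iff
    rwa [hy] at this
  let ρ : Equiv.Perm (T.neighborSet y) := Equiv.Perm.subtypePerm h.toEquiv hadj
  have hρ : ∀ z, (ρ z : V) = h z := fun z => rfl
  refine ⟨e.permCongrHom ρ, ?_, fun z => ?_⟩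
  · rw [← he]
    exact ⟨ρ, ⟨h, hH, hy, hρ⟩, rfl⟩
  · rw [← hρ z]
    simp

theorem exists_mem_apply_neighbor {H : Subgroup (T ≃g T)} {F : Subgroup (Equiv.Perm Ω)}
    (hloc : LocallyPermIsomorphic H F) (htrans : MulAction.IsPretransitive F Ω) {y a b : V}
    (ha : T.Adj y a) (hb : T.Adj y b) : ∃ h ∈ H, h y = y ∧ h a = b := by
  obtain ⟨e, he⟩ := hloc y
  obtain ⟨σ, hσ⟩ := htrans.exists_smul_eq (e ⟨a, ha⟩) (e ⟨b, hb⟩)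
  obtain ⟨h, hH, hy, hi⟩ := exists_induces_of_mem he σ.2
  refine ⟨h, hH, hy, ?_⟩
  have := hi ⟨a, ha⟩
  rw [← this, show σ.1 (e ⟨a, ha⟩) = e ⟨b, hb⟩ from hσ, Equiv.symm_apply_apply]

/-- The condition on subnormal subgroups of point stabilizers, transported to the tree. -/
theorem exists_mem_apply_of_normal {H : Subgroup (T ≃g T)} {F : Subgroup (Equiv.Perm Ω)}
    (hloc : LocallyPermIsomorphic H F)
    (hsub : ∀ (ω : Ω) (N : Subgroup (MulAction.stabilizer F ω)), N.IsSubnormal → N ≠ ⊥ →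
      ∀ a b : Ω, a ≠ ω → b ≠ ω → ∃ n ∈ N, n • a = b)
    {L : Subgroup (T ≃g T)} (hLH : L ≤ H) (hnorm : ∀ h ∈ H, ∀ n ∈ L, h * n * h⁻¹ ∈ L)
    {x y : V} (hxy : T.Adj y x) {g : T ≃g T} (hg : g ∈ L) (hgx : g x = x) (hgy : g y = y)
    {w : V} (hw : T.Adj y w) (hgw : g w ≠ w) {a b : V} (ha : T.Adj y a) (hax : a ≠ x)
    (hb : T.Adj y b) (hbx : b ≠ x) : ∃ n ∈ L, n x = x ∧ n y = y ∧ n a = b := by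
  obtain ⟨e, he⟩ := hloc y
  set ω : Ω := e ⟨x, hxy⟩ with hω
  have fixω : ∀ {σ : Equiv.Perm Ω} {h : T ≃g T}, Induces e σ h → (σ ω = ω ↔ h x = x) := by
    intro σ h hi
    have := hi ⟨x, hxy⟩
    rw [← hω] at this
    rw [← show _ = h x from this]
    constructor
    · intro h
      rw [h, hω, Equiv.symm_apply_apply]
    · intro h
      have : e.symm (σ ω) = ⟨x, hxy⟩ := Subtype.ext h
      rw [Equiv.symm_apply_eq] at this
      exact this
  -- The image in `F_ω` of the fixator in `L` of the arc `(x, y)`. It is normal because `H`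
  -- normalizes `L`, and non-trivial because `g` moves `w`.
  let N : Subgroup (MulAction.stabilizer F ω) :=
    { carrier := {σ | ∃ n ∈ L, n x = x ∧ n y = y ∧ Induces e σ.1.1 n}
      one_mem' := ⟨1, L.one_mem, rfl, rfl, Induces.one e⟩
      mul_mem' := by
        rintro σ τ ⟨m, hm, mx, my, hσ⟩ ⟨n, hn, nx, ny, hτ⟩
        refine ⟨m * n, L.mul_mem hm hn, ?_, ?_, hσ.mul hτ⟩
        · rw [RelIso.mul_apply, nx, mx]
        · rw [RelIso.mul_apply, ny, my]
      inv_mem' := by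
        rintro σ ⟨m, hm, mx, my, hσ⟩
        refine ⟨m⁻¹, L.inv_mem hm, ?_, ?_, hσ.inv⟩
        · nth_rewrite 1 [← mx]; exact RelIso.inv_apply_self m x
        · nth_rewrite 1 [← my]; exact RelIso.inv_apply_self m y }
  have hN : N.Normal := by
    refine ⟨?_⟩
    rintro σ ⟨n, hn, nx, ny, hσ⟩ τ
    obtain ⟨h, hH, hy, hτ⟩ := exists_induces_of_mem he τ.1.2
    have hx : h x = x := (fixω hτ).mp τ.2
    have hix : h⁻¹ x = x := by nth_rewrite 1 [← hx]; exact RelIso.inv_apply_self h x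
    have hiy : h⁻¹ y = y := by nth_rewrite 1 [← hy]; exact RelIso.inv_apply_self h y
    refine ⟨h * n * h⁻¹, hnorm h hH n hn, ?_, ?_, (hτ.mul hσ).mul hτ.inv⟩
    · rw [RelIso.mul_apply, RelIso.mul_apply, hix, nx, hx]
    · rw [RelIso.mul_apply, RelIso.mul_apply, hiy, ny, hy]
  have hne : N ≠ ⊥ := by
    obtain ⟨σ, hσF, hσ⟩ := exists_induced he (hLH hg) hgy
    intro hbot
    have hmem : (⟨⟨σ, hσF⟩, (fixω hσ).mpr hgx⟩ : MulAction.stabilizer F ω) ∈ N :=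
      ⟨g, hg, hgx, hgy, hσ⟩
    rw [hbot, Subgroup.mem_bot] at hmem
    have h1 : σ = 1 := congrArg (fun s : MulAction.stabilizer F ω => s.1.1) hmem
    subst h1
    have := hσ ⟨w, hw⟩
    simp only [Equiv.Perm.one_apply, Equiv.symm_apply_apply] at this
    exact hgw this.symm
  have hea : e ⟨a, ha⟩ ≠ ω := fun h => hax (congrArg Subtype.val (e.injective h))
  have heb : e ⟨b, hb⟩ ≠ ω := fun h => hbx (congrArg Subtype.val (e.injective h))
  obtain ⟨σ, ⟨n, hn, nx, ny, hσ⟩, hab⟩ := hsub ω N hN.isSubnormal hne _ _ hea heb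
  refine ⟨n, hn, nx, ny, ?_⟩
  rw [← hσ ⟨a, ha⟩, show σ.1.1 (e ⟨a, ha⟩) = e ⟨b, hb⟩ from hab, Equiv.symm_apply_apply]

/-- An automorphism fixing an edge and moving some vertex fixes an arc `(x, y)` and moves a
neighbour of `y`. -/
theorem exists_fixed_arc (hT : T.IsTree) {g : T ≃g T} {x y v : V} (hxy : T.Adj x y) (hx : g x = x)
    (hy : g y = y) (hv : g v ≠ v) :
    ∃ x' y' w, T.Adj x' y' ∧ T.Adj y' w ∧ g x' = x' ∧ g y' = y' ∧ g w ≠ w := by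
  have key : ∀ {u v : V} (p : T.Walk u v) (t : V), T.Adj t u → g t = t → g u = u → g v ≠ v →
      ∃ x' y' w, T.Adj x' y' ∧ T.Adj y' w ∧ g x' = x' ∧ g y' = y' ∧ g w ≠ w := by
    intro u v p
    induction p with
    | nil => exact fun t _ _ h h' => absurd h h'
    | @cons u w v h q ih =>
      intro t htu ht hu hv
      by_cases hw : g w = w
      · exact ih u h hu hw hv
      · exact ⟨t, u, w, htu, h, ht, hu, hw⟩
  obtain ⟨p, -⟩ := hT.connected.exists_walk_length_eq_dist y v
  exact key p x hxy hx hy hv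

/-- A locally transitive group with an inversion is transitive on arcs. -/
theorem exists_mem_apply_arc (hT : T.IsTree) {H : Subgroup (T ≃g T)} {F : Subgroup (Equiv.Perm Ω)}
    (hloc : LocallyPermIsomorphic H F) (htrans : MulAction.IsPretransitive F Ω)
    (hinv : HasInvolutiveInversion H) {x y x' y' : V} (hxy : T.Adj x y) (hxy' : T.Adj x' y') :
    ∃ h ∈ H, h x = x' ∧ h y = y' := by
  obtain ⟨i, hi, -, a, b, hab, hia, hib⟩ := hinv
  have hvert : ∀ {u v : V} (p : T.Walk u v), (∃ h ∈ H, h a = u) → ∃ h ∈ H, h a = v := by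
    intro u v p
    induction p with
    | nil => exact id
    | @cons u w v huw q ih =>
      rintro ⟨h, hH, rfl⟩
      apply ih
      have hb : T.Adj a (h⁻¹ w) := by
        have : T.Adj (h a) (h (h⁻¹ w)) ↔ T.Adj a (h⁻¹ w) := h.map_rel_iff
        rw [RelIso.apply_inv_self] at this
        exact this.mp huw
      obtain ⟨t, ht, hta, htb⟩ := exists_mem_apply_neighbor hloc htrans hab hb
      -- The inversion takes `a` to `b`, `t` rotates `b` about `a` to `h⁻¹ w`, and `h` takes this to
      -- `w`.
      refine ⟨h * t * i, H.mul_mem (H.mul_mem hH ht) hi, ?_⟩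
      rw [RelIso.mul_apply, RelIso.mul_apply, hia, htb, RelIso.apply_inv_self]
  have hvert' : ∀ v, ∃ h ∈ H, h a = v := fun v => by
    obtain ⟨p, -⟩ := hT.connected.exists_walk_length_eq_dist a v
    exact hvert p ⟨1, H.one_mem, rfl⟩
  have harc : ∀ {u v : V}, T.Adj u v → ∃ h ∈ H, h a = u ∧ h b = v := by
    intro u v huv
    obtain ⟨h, hH, rfl⟩ := hvert' u
    have hb : T.Adj (h a) (h b) := h.map_rel_iff.mpr hab
    obtain ⟨t, ht, hta, htb⟩ := exists_mem_apply_neighbor hloc htrans hb huv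
    exact ⟨t * h, H.mul_mem ht hH, hta, htb⟩
  obtain ⟨h, hH, rfl, rfl⟩ := harc hxy
  obtain ⟨h', hH', rfl, rfl⟩ := harc hxy'
  exact ⟨h' * h⁻¹, H.mul_mem hH' (H.inv_mem hH), by simp [RelIso.mul_apply],
    by simp [RelIso.mul_apply]⟩

theorem exists_neighbor_ne {d : ℕ} (hd : 3 ≤ d) [T.LocallyFinite] (hreg : T.IsRegularOfDegree d)
    (y x w : V) : ∃ z, T.Adj y z ∧ z ≠ x ∧ z ≠ w := by
  classical
  have h1 : (T.neighborFinset y).card = d := hreg y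
  obtain ⟨z, hz, hz'⟩ := Finset.exists_mem_notMem_of_card_lt_card (s := {x, w})
    (t := T.neighborFinset y) (by have := Finset.card_le_two (a := x) (b := w); omega)
  simp only [Finset.mem_insert, Finset.mem_singleton, not_or] at hz'
  exact ⟨z, by simpa using hz, hz'.1, hz'.2⟩

/-- Non-discreteness yields a non-trivial generator, and a path from its fixed edge to a moved
vertex yields a fixed arc with a moved neighbour. Arc-transitivity of `H`, which normalizes the
group, carries this to every arc; there the local condition gives transitivity on the remaining
neighbours. -/
theorem edgeMoving_plusSubgroup {d : ℕ} (hd : 3 ≤ d) [T.LocallyFinite] (hT : T.IsTree)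
    (hreg : T.IsRegularOfDegree d) {F : Subgroup (Equiv.Perm Ω)} {H : Subgroup (T ≃g T)}
    (hdisc : ¬ DiscreteTopology H) (hloc : LocallyPermIsomorphic H F)
    (hinv : HasInvolutiveInversion H) (htrans : MulAction.IsPretransitive F Ω)
    (hsub : ∀ (ω : Ω) (N : Subgroup (MulAction.stabilizer F ω)), N.IsSubnormal → N ≠ ⊥ →
      ∀ a b : Ω, a ≠ ω → b ≠ ω → ∃ n ∈ N, n • a = b) (k : ℕ) :
    EdgeMoving (plusSubgroup H k) := by
  have hnorm : ∀ h ∈ H, ∀ n ∈ plusSubgroup H k, h * n * h⁻¹ ∈ plusSubgroup H k :=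
    fun h hH n hn => conj_mem_plusSubgroup hT.connected
      (fun m hm => H.mul_mem (H.mul_mem hH hm) (H.inv_mem hH)) hn
  obtain ⟨-, -, -, a, b, hab, -⟩ := id hinv
  obtain ⟨g, hgH, hgfix, hg1⟩ := exists_ne_one_of_not_discrete hdisc
    ((finite_closedBall hT.connected a (k - 1)).union (finite_closedBall hT.connected b (k - 1)))
  have hg : g ∈ plusSubgroup H k :=
    Subgroup.subset_closure ⟨hgH, a, b, hab, fun v hv => hgfix v hv⟩
  obtain ⟨v, hv⟩ : ∃ v, g v ≠ v := by
    by_contra! h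
    exact hg1 (RelIso.ext h)
  obtain ⟨x, y, w, hxy, hyw, hgx, hgy, hgw⟩ := exists_fixed_arc hT hab
    (hgfix a (Or.inl (by simp))) (hgfix b (Or.inr (by simp))) hv
  intro x' y' w' hxy' hyw' hne
  obtain ⟨h, hH, rfl, rfl⟩ := exists_mem_apply_arc hT hloc htrans hinv hxy hxy'
  -- Since `d ≥ 3`, there is a third neighbour to which `w'` can be moved.
  obtain ⟨z, hz, hzx, hzw⟩ := exists_neighbor_ne hd hreg (h y) (h x) w'
  have hg' := hnorm h hH g hg
  have conj_apply : ∀ u, (h * g * h⁻¹) (h u) = h (g u) := fun u => by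
    rw [RelIso.mul_apply, RelIso.mul_apply, RelIso.inv_apply_self]
  obtain ⟨n, hn, hnx, hny, hnw⟩ := exists_mem_apply_of_normal hloc hsub (plusSubgroup_le H k) hnorm
    hxy'.symm hg' (by rw [conj_apply, hgx]) (by rw [conj_apply, hgy])
    (w := h w) (h.map_rel_iff.mpr hyw) (by rw [conj_apply]; exact fun e => hgw (h.injective e))
    hyw' hne hz hzx
  exact ⟨n, hn, hnx, hny, hnw ▸ hzw⟩

/-! ### Recovering the tree from an edge-moving group -/

theorem EdgeMoving.mono {N M : Subgroup (T ≃g T)} (hN : EdgeMoving N) (h : N ≤ M) : EdgeMoving M :=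
  fun x y w hxy hyw hne =>
    let ⟨g, hg, hgg⟩ := hN x y w hxy hyw hne
    ⟨g, h hg, hgg⟩

/-- The fixator of an edge fixes only the endpoints of this edge. -/
theorem EdgeMoving.eq_or_eq {N : Subgroup (T ≃g T)} (hN : EdgeMoving N) (hT : T.IsTree) {x y z : V}
    (hxy : T.Adj x y) (hz : ∀ g ∈ N, g x = x → g y = y → g z = z) : z = x ∨ z = y := by
  have key : ∀ {x y : V}, T.Adj x y → (∀ g ∈ N, g x = x → g y = y → g z = z) →
      T.dist x z = T.dist y z + 1 → z = y := by
    intro x y hxy hz hd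
    by_contra hne
    obtain ⟨w, hyw, hw⟩ := exists_adj_dist_lt hT.connected (Ne.symm hne)
    have hwx : w ≠ x := by rintro rfl; omega
    obtain ⟨g, hg, hgx, hgy, hgw⟩ := hN x y w hxy hyw hwx
    exact hgw (fix_of_fix_of_dist_lt hT hgy (hz g hg hgx hgy) hyw (by omega))
  rcases dist_adj hT hxy z with h | h
  · exact Or.inr (key hxy hz h)
  · exact Or.inl (key hxy.symm (fun g hg hy hx => hz g hg hx hy) h)

/-- A vertex stabilizer fixes no other vertex. -/
theorem EdgeMoving.eq_of_fix {N : Subgroup (T ≃g T)} (hN : EdgeMoving N) (hT : T.IsTree)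
    [T.LocallyFinite] {d : ℕ} (hd : 3 ≤ d) (hreg : T.IsRegularOfDegree d) {x z : V}
    (hz : ∀ g ∈ N, g x = x → g z = z) : z = x := by
  obtain ⟨y, hy, -, -⟩ := exists_neighbor_ne hd hreg x x x
  obtain ⟨y', hy', hne, -⟩ := exists_neighbor_ne hd hreg x y y
  rcases hN.eq_or_eq hT hy (fun g hg hx _ => hz g hg hx) with h | rfl
  · exact h
  · exact (hN.eq_or_eq hT hy' (fun g hg hx _ => hz g hg hx)).resolve_right hne.symm

/-- The fixator of two vertices fixes the geodesic between them, so non-adjacent vertices have a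
further common fixed vertex. The criterion mentions only fixed points of elements of `N`, hence is
transported by isomorphisms that match stabilizers. -/
theorem EdgeMoving.adj_iff {N : Subgroup (T ≃g T)} (hN : EdgeMoving N) (hT : T.IsTree) {x y : V} :
    T.Adj x y ↔
      x ≠ y ∧ ∀ z, (∀ g : N, g.1 x = x → g.1 y = y → g.1 z = z) → z = x ∨ z = y := by
  refine ⟨fun h => ⟨h.ne, fun z hz => hN.eq_or_eq hT h fun g hg => hz ⟨g, hg⟩⟩, fun ⟨hne, h⟩ => ?_⟩
  obtain ⟨u, hu, hd⟩ := exists_adj_dist_lt hT.connected hne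
  rcases h u fun g hx hy => fix_of_fix_of_dist_lt hT hx hy hu (by omega) with rfl | rfl
  · exact absurd rfl hu.ne
  · exact hu

/-! ### Isomorphisms are conjugations -/

/-- A continuous isomorphism maps vertex stabilizers to groups with finite orbits, hence into vertex
stabilizers. -/
theorem exists_fixed_of_continuous [T.LocallyFinite] (hT : T.IsTree) {N M : Subgroup (T ≃g T)}
    (hM : ∀ g ∈ M, ∀ v, Even (T.dist v (g v))) (φ : N →* M) (hφ : Continuous φ) (x : V) :
    ∃ v, ∀ g : N, g.1 x = x → (φ g).1 v = v := by
  let K : Subgroup (T ≃g T) :=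
    { carrier := {h | ∃ g : N, g.1 x = x ∧ (φ g).1 = h}
      one_mem' := ⟨1, rfl, by simp⟩
      mul_mem' := by
        rintro _ _ ⟨g, hg, rfl⟩ ⟨h, hh, rfl⟩
        refine ⟨g * h, ?_, by simp⟩
        rw [Subgroup.coe_mul, RelIso.mul_apply, hh, hg]
      inv_mem' := by
        rintro _ ⟨g, hg, rfl⟩
        refine ⟨g⁻¹, ?_, by simp⟩
        nth_rewrite 1 [← hg]
        exact RelIso.inv_apply_self g.1 x }
  have hopen : IsOpen {g : N | (φ g).1 x = x} :=
    (isOpen_apply_eq x x).preimage (continuous_subtype_val.comp hφ)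
  obtain ⟨W, hW, hWeq⟩ := isOpen_induced_iff.mp hopen
  have h1W : (1 : T ≃g T) ∈ W := by
    have : (1 : N) ∈ Subtype.val ⁻¹' W := by rw [hWeq]; simp
    exact this
  obtain ⟨S, hS, hSW⟩ := exists_finite_of_isOpen hW h1W
  have hfix : ∀ g : N, (∀ s ∈ S, g.1 s = s) → (φ g).1 x = x := fun g hg => by
    have : g ∈ Subtype.val ⁻¹' W := hSW g.1 hg
    rwa [hWeq] at this
  have hfin : {v | ∃ h ∈ K, h x = v}.Finite := by
    have hc : ∀ v, ∃ g : N, v ∈ {v | ∃ h ∈ K, h x = v} → g.1 x = x ∧ (φ g).1 x = v := by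
      intro v
      by_cases hv : v ∈ {v | ∃ h ∈ K, h x = v}
      · obtain ⟨_, ⟨g, hg, rfl⟩, hv⟩ := hv
        exact ⟨g, fun _ => ⟨hg, hv⟩⟩
      · exact ⟨1, fun h => absurd h hv⟩
    -- An orbit point `v` is determined by the restriction of `c v` to `S`; as `c v` fixes `x`, it
    -- preserves distances to `x`, so only finitely many restrictions occur.
    choose c hc using hc
    have := hS.to_subtype
    refine Set.Finite.of_injOn (f := fun v (s : S) => (c v).1 s)
      (t := Set.pi Set.univ fun s : S => {u | T.dist x u ≤ T.dist x s}) ?_ ?_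
      (Set.Finite.pi fun s => finite_closedBall hT.connected x _)
    · intro v hv s _
      have := dist_apply hT.connected (c v).1 x s
      rw [(hc v hv).1] at this
      exact this.le
    · intro v hv w hw hvw
      have h1 := hfix ((c v)⁻¹ * c w) fun s hs => by
        rw [Subgroup.coe_mul, RelIso.mul_apply, ← show (c v).1 s = (c w).1 s from congrFun hvw ⟨s, hs⟩]
        exact RelIso.inv_apply_self (c v).1 s
      rw [map_mul, map_inv, Subgroup.coe_mul, RelIso.mul_apply, (hc w hw).2] at h1
      have h2 := congrArg (φ (c v)).1 h1
      rw [(hc v hv).2] at h2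
      rw [← h2]
      exact RelIso.apply_inv_self (φ (c v)).1 w
  obtain ⟨v, hv⟩ := exists_fixed_of_finite_orbit hT K
    (by rintro _ ⟨g, -, rfl⟩; exact hM _ (φ g).2) x hfin
  exact ⟨v, fun g hg => hv _ ⟨g, hg, rfl⟩⟩

/-- Isomorphisms of topological groups between edge-moving type-preserving groups of tree
automorphisms are conjugations. -/
theorem exists_conj_of_continuousMulEquiv [T.LocallyFinite] (hT : T.IsTree) {d : ℕ} (hd : 3 ≤ d)
    (hreg : T.IsRegularOfDegree d) {N M : Subgroup (T ≃g T)} (hN : EdgeMoving N)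
    (hM : EdgeMoving M) (hNe : ∀ g ∈ N, ∀ v, Even (T.dist v (g v)))
    (hMe : ∀ g ∈ M, ∀ v, Even (T.dist v (g v))) (φ : N ≃ₜ* M) :
    ∃ α : T ≃g T, ∀ g : N, (φ g).1 = α * g.1 * α⁻¹ := by
  choose a ha using exists_fixed_of_continuous hT hMe (φ : N →* M) φ.continuous
  choose b hb using exists_fixed_of_continuous hT hNe (φ.symm : M →* N) φ.symm.continuous
  replace ha : ∀ (x : V) (g : N), g.1 x = x → (φ g).1 (a x) = a x := ha
  replace hb : ∀ (x : V) (g : M), g.1 x = x → (φ.symm g).1 (b x) = b x := hb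
  have hba : ∀ x, b (a x) = x := fun x => hN.eq_of_fix hT hd hreg fun g hg hgx => by
    have := hb _ _ (ha x ⟨g, hg⟩ hgx)
    rwa [φ.symm_apply_apply] at this
  have hab : ∀ x, a (b x) = x := fun x => hM.eq_of_fix hT hd hreg fun g hg hgx => by
    have := ha _ _ (hb x ⟨g, hg⟩ hgx)
    rwa [φ.apply_symm_apply] at this
  have hiff : ∀ (x : V) (g : N), (φ g).1 (a x) = a x ↔ g.1 x = x := fun x g =>
    ⟨fun h => by
      have := hb _ _ h
      rwa [φ.symm_apply_apply, hba] at this, ha x g⟩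
  have hadj : ∀ {x y : V}, T.Adj (a x) (a y) ↔ T.Adj x y := by
    intro x y
    rw [hM.adj_iff hT (x := a x), hN.adj_iff hT (x := x)]
    have hinj : ∀ {u v}, a u = a v ↔ u = v := fun {u v} =>
      ⟨fun h => by rw [← hba u, h, hba], fun h => by rw [h]⟩
    refine and_congr (not_congr hinj) ⟨fun h z hz => ?_, fun h z hz => ?_⟩
    · rw [← hinj, ← hinj (u := z) (v := y)]
      refine h (a z) fun g hx hy => ?_
      have := hz (φ.symm g)
      rw [← hiff, ← hiff, ← hiff, φ.apply_symm_apply] at this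
      exact this hx hy
    · rw [← hab z, hinj, hinj]
      refine h (b z) fun g hx hy => ?_
      rw [← hiff, hab]
      exact hz (φ g) ((hiff x g).mpr hx) ((hiff y g).mpr hy)
  let α : T ≃g T := ⟨⟨a, b, hba, hab⟩, hadj⟩
  -- Any `m ∈ M` fixing `a (g x)` pulls back to an element fixing `g x`. Conjugating by `g` and
  -- mapping forward shows that `m` fixes `φ(g) (a x)`, so the two vertices coincide.
  have hα : ∀ (g : N) (x : V), (φ g).1 (a x) = a (g.1 x) := by
    intro g x
    refine hM.eq_of_fix hT hd hreg fun m hm hmx => ?_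
    have h1 : ((φ.symm ⟨m, hm⟩).1) (g.1 x) = g.1 x := by
      rw [← hiff, φ.apply_symm_apply]
      exact hmx
    have h2 : (g⁻¹ * φ.symm ⟨m, hm⟩ * g).1 x = x := by
      rw [Subgroup.coe_mul, Subgroup.coe_mul, RelIso.mul_apply, RelIso.mul_apply, h1]
      exact RelIso.inv_apply_self g.1 x
    rw [← hiff, map_mul, map_mul, φ.apply_symm_apply, map_inv, Subgroup.coe_mul, Subgroup.coe_mul,
      RelIso.mul_apply, RelIso.mul_apply] at h2
    have h3 := congrArg (φ g).1 h2
    exact (RelIso.apply_inv_self (φ g).1 _).symm.trans h3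
  refine ⟨α, fun g => RelIso.ext fun v => ?_⟩
  rw [RelIso.mul_apply, RelIso.mul_apply]
  have h := hα g (α⁻¹ v)
  have h' : a (α⁻¹ v) = v := RelIso.apply_inv_self α v
  rw [h'] at h
  exact h

/-! ### Closedness and comparison of the plus subgroups -/

/-- `H^{(P_k)} = H ⬝ (H^{(P_k)})^{+_k}`. -/
theorem exists_inv_mul_mem_plusSubgroup (hT : T.Connected) {H : Subgroup (T ≃g T)} {k : ℕ}
    (hk : 1 ≤ k) {x y : V} (hxy : T.Adj x y) {g : T ≃g T} (hg : g ∈ pkClosure hT H k) :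
    ∃ h ∈ H, h⁻¹ * g ∈ plusSubgroup (pkClosure hT H k) k := by
  obtain ⟨h, hH, hh⟩ := hg x
  refine ⟨h, hH, Subgroup.subset_closure ⟨mul_mem (inv_mem (le_pkClosure hT H k hH)) hg, x, y, hxy,
    fun v hv => ?_⟩⟩
  -- For `k ≥ 1`, the subtree `e^{k-1}` lies in the ball of radius `k` around either endpoint of
  -- `e`.
  have hv' : T.dist x v ≤ k := by
    have h1 := hT.dist_triangle (u := x) (v := y) (w := v)
    have h2 := SimpleGraph.dist_eq_one_iff_adj.mpr hxy
    omega
  rw [RelIso.mul_apply, hh v hv', RelIso.inv_apply_self]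

/-- The group `(H^{(P_k)})^{+_k}` is closed for the permutation topology. -/
theorem mem_plusSubgroup_of_forall_finite [T.LocallyFinite] (hT : T.Connected)
    {H : Subgroup (T ≃g T)} {k : ℕ} {x y : V} (hxy : T.Adj x y) {g : T ≃g T}
    (hg : ∀ S : Set V, S.Finite →
      ∃ n ∈ plusSubgroup (pkClosure hT H k) k, ∀ s ∈ S, g s = n s) :
    g ∈ plusSubgroup (pkClosure hT H k) k := by
  have hgk : g ∈ pkClosure hT H k := fun z => by
    obtain ⟨n, hn, hgn⟩ := hg _ (finite_closedBall hT z k)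
    obtain ⟨h, hH, hh⟩ := plusSubgroup_le _ k hn z
    exact ⟨h, hH, fun v hv => (hgn v hv).trans (hh v hv)⟩
  obtain ⟨n, hn, hgn⟩ := hg _ ((finite_closedBall hT x (k - 1)).union
    (finite_closedBall hT y (k - 1)))
  -- Agreement with `n` on a single `e^{k-1}` suffices: `n⁻¹ * g` is then itself a generator.
  have : n⁻¹ * g ∈ plusSubgroup (pkClosure hT H k) k :=
    Subgroup.subset_closure ⟨mul_mem (inv_mem (plusSubgroup_le _ k hn)) hgk, x, y, hxy,
      fun v hv => by rw [RelIso.mul_apply, hgn v hv, RelIso.inv_apply_self]⟩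
  simpa using mul_mem hn this

/-- An automorphism with a fixed vertex has finite order on each finite set of vertices. -/
theorem exists_pow_fix [T.LocallyFinite] (hT : T.Connected) {β : T ≃g T} {x : V} (hx : β x = x)
    {S : Set V} (hS : S.Finite) : ∃ m, ∀ s ∈ S, (β ^ (m + 1)) s = s := by
  obtain ⟨R, hR⟩ : ∃ R, ∀ s ∈ S, T.dist x s ≤ R := by
    obtain ⟨R, hR⟩ := (hS.image (T.dist x)).bddAbove
    exact ⟨R, fun s hs => hR ⟨s, hs, rfl⟩⟩
  have hmem : ∀ v, β v ∈ {v | T.dist x v ≤ R} ↔ v ∈ {v | T.dist x v ≤ R} := fun v => by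
    have := dist_apply hT β x v
    rw [hx] at this
    simp [this]
  have := (finite_closedBall hT x R).to_subtype
  let ρ : Equiv.Perm {v | T.dist x v ≤ R} := Equiv.Perm.subtypePerm β.toEquiv hmem
  have hρ : ∀ (n : ℕ) (v : {v | T.dist x v ≤ R}), ((ρ ^ n) v : V) = (β ^ n) v := by
    intro n
    induction n with
    | zero => intro v; rfl
    | succ n ih =>
      intro v
      rw [pow_succ, pow_succ, Equiv.Perm.mul_apply, RelIso.mul_apply, ih]
      rfl
  obtain ⟨m, hm, hm1⟩ := (isOfFinOrder_of_finite ρ).exists_pow_eq_one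
  obtain ⟨m, rfl⟩ := Nat.exists_eq_succ_of_ne_zero hm.ne'
  refine ⟨m, fun s hs => ?_⟩
  rw [← hρ _ ⟨s, hR s hs⟩, hm1]
  rfl

/-- A closed group that contains one of its conjugates by an automorphism with a fixed vertex is
normalized by this automorphism. -/
theorem conj_inv_mem_of_conj_mem [T.LocallyFinite] (hT : T.Connected) {N : Subgroup (T ≃g T)}
    (hcl : ∀ g, (∀ S : Set V, S.Finite → ∃ n ∈ N, ∀ s ∈ S, g s = n s) → g ∈ N)
    {β : T ≃g T} {x : V} (hx : β x = x) (hβ : ∀ g ∈ N, β * g * β⁻¹ ∈ N) {g : T ≃g T} (hg : g ∈ N) :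
    β⁻¹ * g * β ∈ N := by
  refine hcl _ fun S hS => ?_
  have hpow : ∀ m : ℕ, β ^ m * g * (β ^ m)⁻¹ ∈ N := by
    intro m
    induction m with
    | zero => simpa using hg
    | succ m ih =>
      have : β ^ (m + 1) * g * (β ^ (m + 1))⁻¹ = β * (β ^ m * g * (β ^ m)⁻¹) * β⁻¹ := by
        rw [pow_succ']; group
      exact this ▸ hβ _ ih
  -- If `β ^ (m + 1)` is trivial on `S` and on its image, then `β ^ m` acts as `β⁻¹` where needed,
  -- and `β ^ m * g * (β ^ m)⁻¹` agrees with `β⁻¹ * g * β` on `S`.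
  obtain ⟨m, hm⟩ := exists_pow_fix hT hx (hS.union (hS.image fun s => (β⁻¹ * g * β) s))
  refine ⟨_, hpow m, fun s hs => ?_⟩
  have key : ∀ v, (β ^ (m + 1)) v = v → (β ^ m)⁻¹ v = β v := fun v hv => by
    have : v = (β ^ m) (β v) := by rwa [← RelIso.mul_apply, ← pow_succ, eq_comm]
    nth_rewrite 1 [this]
    exact RelIso.inv_apply_self _ _
  have h1 := key _ (hm _ (Or.inl hs))
  have h2 := key _ (hm _ (Or.inr ⟨s, hs, rfl⟩))
  have h3 : β ((β⁻¹ * g * β) s) = g (β s) := by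
    rw [RelIso.mul_apply, RelIso.mul_apply, RelIso.apply_inv_self]
  rw [RelIso.mul_apply (β ^ m * g), RelIso.mul_apply (β ^ m), h1, ← h3, ← h2,
    RelIso.apply_inv_self]

theorem pkClosure_eq_of_continuousMulEquiv {d : ℕ} (hd : 3 ≤ d)
    [T.LocallyFinite] (hT : T.IsTree) (hreg : T.IsRegularOfDegree d)
    {F : Subgroup (Equiv.Perm Ω)} {H : Subgroup (T ≃g T)}
    (hdisc : ¬ DiscreteTopology H) (hloc : LocallyPermIsomorphic H F)
    (hinv : HasInvolutiveInversion H) (htrans : MulAction.IsPretransitive F Ω)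
    (hsub : ∀ (ω : Ω) (N : Subgroup (MulAction.stabilizer F ω)), N.IsSubnormal → N ≠ ⊥ →
      ∀ a b : Ω, a ≠ ω → b ≠ ω → ∃ n ∈ N, n • a = b)
    {k l : ℕ} (hk : 1 ≤ k) (hkl : k ≤ l)
    (φ : plusSubgroup (pkClosure hT.connected H k) k ≃ₜ*
      plusSubgroup (pkClosure hT.connected H l) l) :
    pkClosure hT.connected H k = pkClosure hT.connected H l := by
  have hedge : ∀ m, EdgeMoving (plusSubgroup (pkClosure hT.connected H m) m) := fun m =>
    (edgeMoving_plusSubgroup hd hT hreg hdisc hloc hinv htrans hsub m).mono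
      (plusSubgroup_anti (le_pkClosure hT.connected H m) le_rfl)
  obtain ⟨α, hα⟩ := exists_conj_of_continuousMulEquiv hT hd hreg (hedge k) (hedge l)
    (fun _ => even_dist_of_mem_plusSubgroup hT) (fun _ => even_dist_of_mem_plusSubgroup hT) φ
  have hnorm : ∀ h ∈ H, ∀ m, ∀ n ∈ plusSubgroup (pkClosure hT.connected H m) m,
      h * n * h⁻¹ ∈ plusSubgroup (pkClosure hT.connected H m) m := fun h hH m n hn => by
    have hm := le_pkClosure hT.connected H m hH
    exact conj_mem_plusSubgroup hT.connected (fun _ hg => mul_mem (mul_mem hm hg) (inv_mem hm)) hn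
  have hle := plusSubgroup_anti (pkClosure_anti hT.connected H hkl) hkl
  obtain ⟨-, -, -, x, y, hxy, -⟩ := id hinv
  -- Correcting `α` by an element of `H` makes it fix `x` without leaving the normalizing action on
  -- the target.
  obtain ⟨h, hH, hhx, -⟩ := exists_mem_apply_arc hT hloc htrans hinv
    (α.map_rel_iff.mpr hxy) hxy
  have hβ : ∀ g ∈ plusSubgroup (pkClosure hT.connected H k) k,
      (h * α) * g * (h * α)⁻¹ ∈ plusSubgroup (pkClosure hT.connected H l) l := fun g hg => by
    have := hnorm h hH l _ (φ ⟨g, hg⟩).2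
    rw [hα] at this
    convert this using 1
    group
  -- With `β = h * α`, write `g = β * (β⁻¹ * g * β) * β⁻¹`; the inner factor lies in the `k`-group,
  -- so `g` lies in the `l`-group.
  have hge : plusSubgroup (pkClosure hT.connected H k) k ≤
      plusSubgroup (pkClosure hT.connected H l) l := fun g hg => by
    have := hβ _ (conj_inv_mem_of_conj_mem hT.connected
      (fun _ => mem_plusSubgroup_of_forall_finite hT.connected hxy) (β := h * α) (x := x) hhx
      (fun g hg => hle (hβ g hg)) hg)
    convert this using 1
    group
  refine le_antisymm (fun g hg => ?_) (pkClosure_anti hT.connected H hkl)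
  obtain ⟨h, hH, hh⟩ := exists_inv_mul_mem_plusSubgroup hT.connected hk hxy hg
  have := mul_mem (le_pkClosure hT.connected H l hH) (plusSubgroup_le _ l (hge hh))
  rwa [mul_inv_cancel_left] at this

end TreeAut

theorem mainTheorem9 {V Ω : Type*} (d : ℕ) (hd : 3 ≤ d)
    (T : SimpleGraph V) [T.LocallyFinite] (hT : T.IsTree) (hreg : T.IsRegularOfDegree d)
    (hΩ : Nat.card Ω = d) (F : Subgroup (Equiv.Perm Ω)) (H : Subgroup (T ≃g T))
    (hdisc : ¬ DiscreteTopology H)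
    (hloc : TreeAut.LocallyPermIsomorphic H F)
    (hinv : TreeAut.HasInvolutiveInversion H)
    (htrans : MulAction.IsPretransitive F Ω)
    (hsub : ∀ (ω : Ω) (N : Subgroup (MulAction.stabilizer F ω)), N.IsSubnormal → N ≠ ⊥ →
      ∀ a b : Ω, a ≠ ω → b ≠ ω → ∃ n ∈ N, n • a = b)
    (k l : ℕ) (hk : 1 ≤ k) (hl : 1 ≤ l)
    (hne : TreeAut.pkClosure hT.connected H k ≠ TreeAut.pkClosure hT.connected H l) :
    IsEmpty (TreeAut.plusSubgroup (TreeAut.pkClosure hT.connected H k) k ≃ₜ*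
      TreeAut.plusSubgroup (TreeAut.pkClosure hT.connected H l) l) := by
  refine ⟨fun φ => hne ?_⟩
  rcases le_total k l with hkl | hlk
  · exact TreeAut.pkClosure_eq_of_continuousMulEquiv hd hT hreg hdisc hloc hinv htrans hsub hk hkl φ
  · exact (TreeAut.pkClosure_eq_of_continuousMulEquiv hd hT hreg hdisc hloc hinv htrans hsub hl hlk
      φ.symm).symm
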